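/- Let $m,n$ be square-free integers with $m\equiv 3$ and $n\equiv 2\pmod 4$, let $L=\mathbb{Q}(\sqrt m,\sqrt n)$ (a biquadratic extension of $\mathbb{Q}$), $d=\gcd(m,n)$ and $k=mn/d^2$. Let $G=\mathrm{Gal}(L/\mathbb{Q})=\langle\sigma,\tau\rangle$, where $\sigma(\sqrt m)=-\sqrt m$, $\sigma(\sqrt n)=\sqrt n$, $\tau(\sqrt m)=\sqrt m$, $\tau(\sqrt n)=-\sqrt n$. Put $(\sigma_1,\tau_1)=(\sigma,\tau)$, $(\sigma_2,\tau_2)=(\tau,\sigma)$, $(\sigma_3,\tau_3)=(\sigma,\sigma\tau)$. For $i\in\{1,2,3\}$ let $N_i=\langle\mu_i,\eta_i\rangle\le\mathrm{Perm}(G)$, where $\mu_i=\lambda(\tau_i)$ is left translation by $\tau_i$ and $\eta_i$ is the 4-cycle $(1,\sigma_i\tau_i,\tau_i,\sigma_i)$. Let $H_i=L[N_i]^G$, where $G$ acts on $L$ by Galois automorphisms and on $N_i$ by conjugation by left translations; $H_i$ acts on $L$ by $\big(\sum_{\eta} c_\eta\eta\big)\cdot x=\sum_\eta c_\eta\,(\eta^{-1}(1_G))(x)$.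 Thus $H_1,H_2,H_3$ are the three non-classical Hopf-Galois structures on $L/\mathbb{Q}$, corresponding respectively to $\sqrt m,\sqrt n,\sqrt k$. Let $\mathfrak{A}_{H_i}=\{h\in H_i : h\cdot\mathcal{O}_L\subseteq\mathcal{O}_L\}$ be the associated order of $\mathcal{O}_L$ in $H_i$. 1. If $m>0$, then $\mathcal{O}_L$ is not free as an $\mathfrak{A}_{H_1}$-module unless $m$ and $n$ are coprime or $m$ divides $n$. 2. If $n>0$, then $\mathcal{O}_L$ is not free as an $\mathfrak{A}_{H_2}$-module unless $n=2d$. 3. If $k>0$, then $\mathcal{O}_L$ is not free as an $\mathfrak{A}_{H_3}$-module unless $|n|=2d$. -/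

import Mathlib

open scoped NumberField

namespace HopfGalois

noncomputable section

/-!
Greither-Pareigis description of Hopf-Galois structures.  Let `L/K` be a Galois extension of fields
with group `G = L ≃ₐ[K] L`, and let `N` be a regular subgroup of `Perm G` normalized by the left
translations `λ(G)`.  The corresponding Hopf-Galois structure is the algebra `H = L[N]^G`, where
`G` acts on `L` by Galois automorphisms and on `N` by conjugation through `λ`; it acts on `L` by
`(∑ c_η η) · x = ∑ c_η (η⁻¹(1_G))(x)`.
-/

/-- The action of `g` on `L[Perm G]`: Galois action on coefficients and conjugation by the left
translation `λ(g)` on permutations, `c η ↦ g(c) (λ(g) η λ(g)⁻¹)`. -/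
def semilinearConj {K L : Type*} [Field K] [Field L] [Algebra K L] (g : L ≃ₐ[K] L) :
    MonoidAlgebra L (Equiv.Perm (L ≃ₐ[K] L)) →ₐ[K]
      MonoidAlgebra L (Equiv.Perm (L ≃ₐ[K] L)) :=
  (MonoidAlgebra.mapDomainAlgHom K L (MulAut.conj (Equiv.mulLeft g)).toMonoidHom).comp
    (MonoidAlgebra.mapAlgHom (Equiv.Perm (L ≃ₐ[K] L)) (g : L →ₐ[K] L))

/-- The `K`-algebra `H = L[N]^G`: the elements of `L[N]` (inside `L[Perm G]`) that are fixed by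
all `g ∈ G`. -/
def hopfAlgebra {K L : Type*} [Field K] [Field L] [Algebra K L]
    (N : Subgroup (Equiv.Perm (L ≃ₐ[K] L))) :
    Subalgebra K (MonoidAlgebra L (Equiv.Perm (L ≃ₐ[K] L))) :=
  (MonoidAlgebra.mapDomainAlgHom K L N.subtype).range ⊓
    ⨅ g : L ≃ₐ[K] L, AlgHom.equalizer (semilinearConj g) (AlgHom.id K _)

/-- The map `L[Perm G] → End_K(L)`, `∑ c_η η ↦ (x ↦ ∑ c_η (η⁻¹(1_G))(x))`. -/
def actionMap (K L : Type*) [Field K] [Field L] [Algebra K L] :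
    MonoidAlgebra L (Equiv.Perm (L ≃ₐ[K] L)) →ₗ[K] Module.End K L :=
  (Finsupp.lsum K fun η : Equiv.Perm (L ≃ₐ[K] L) =>
      (LinearMap.toSpanSingleton L (Module.End K L)
        ((η⁻¹ 1 : L ≃ₐ[K] L).toLinearMap)).restrictScalars K) ∘ₗ
    (MonoidAlgebra.coeffLinearEquiv K).toLinearMap

theorem actionMap_single {K L : Type*} [Field K] [Field L] [Algebra K L]
    (η : Equiv.Perm (L ≃ₐ[K] L)) (c x : L) :
    actionMap K L (MonoidAlgebra.single η c) x = c * (η⁻¹ 1 : L ≃ₐ[K] L) x := by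
  simp [actionMap]

theorem semilinearConj_single {K L : Type*} [Field K] [Field L] [Algebra K L]
    (g : L ≃ₐ[K] L) (η : Equiv.Perm (L ≃ₐ[K] L)) (c : L) :
    semilinearConj g (MonoidAlgebra.single η c) =
      MonoidAlgebra.single (Equiv.mulLeft g * η * (Equiv.mulLeft g)⁻¹) (g c) := by
  simp [semilinearConj]

theorem actionMap_single_mul {K L : Type*} [Field K] [Field L] [Algebra K L]
    (η : Equiv.Perm (L ≃ₐ[K] L)) (c : L) (y : MonoidAlgebra L (Equiv.Perm (L ≃ₐ[K] L))) :
    actionMap K L (MonoidAlgebra.single η c * semilinearConj (η⁻¹ 1) y) =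
      actionMap K L (MonoidAlgebra.single η c) * actionMap K L y := by
  induction y using MonoidAlgebra.induction_linear with
  | zero => simp
  | add f g hf hg => simp only [map_add, mul_add, hf, hg]
  | single θ e =>
    ext x
    rw [semilinearConj_single, MonoidAlgebra.single_mul_single, Module.End.mul_apply,
      actionMap_single, actionMap_single, actionMap_single, map_mul, mul_assoc]
    congr 2
    rw [← AlgEquiv.mul_apply]
    congr 1
    simp [mul_inv_rev, Equiv.Perm.mul_apply]

theorem actionMap_mul {K L : Type*} [Field K] [Field L] [Algebra K L]
    (h y : MonoidAlgebra L (Equiv.Perm (L ≃ₐ[K] L)))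
    (hy : ∀ g : L ≃ₐ[K] L, semilinearConj g y = y) :
    actionMap K L (h * y) = actionMap K L h * actionMap K L y := by
  induction h using MonoidAlgebra.induction_linear with
  | zero => simp
  | add f g hf hg => simp only [map_add, add_mul, hf, hg]
  | single η c =>
    have := actionMap_single_mul η c y
    rwa [hy] at this

/-- The representation `ρ_H : H → End_K(L)` giving the action of `H = L[N]^G` on `L`. -/
def action {K L : Type*} [Field K] [Field L] [Algebra K L]
    (N : Subgroup (Equiv.Perm (L ≃ₐ[K] L))) :
    hopfAlgebra N →ₐ[K] Module.End K L :=
  AlgHom.ofLinearMap (actionMap K L ∘ₗ (hopfAlgebra N).val.toLinearMap)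
    (by
      ext x
      simp [MonoidAlgebra.one_def, actionMap_single])
    (by
      intro h y
      refine actionMap_mul _ _ fun g => ?_
      have := y.2.2
      rw [SetLike.mem_coe, Algebra.mem_iInf] at this
      exact this g)

/-- The associated order `𝔄_H = {h ∈ H | h · 𝓞_L ⊆ 𝓞_L}`. -/
def associatedOrder {K L : Type*} [Field K] [Field L] [Algebra K L]
    (N : Subgroup (Equiv.Perm (L ≃ₐ[K] L))) : Subring (hopfAlgebra N) where
  carrier := {h | ∀ x : L, IsIntegral ℤ x → IsIntegral ℤ (action N h x)}
  mul_mem' := fun {h y} hh hy x hx => by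
    rw [map_mul]
    exact hh _ (hy x hx)
  one_mem' := fun x hx => by rwa [map_one]
  add_mem' := fun {h y} hh hy x hx => by
    rw [map_add]
    exact (hh x hx).add (hy x hx)
  zero_mem' := fun x _ => by
    rw [map_zero]
    exact isIntegral_zero
  neg_mem' := fun {h} hh x hx => by
    rw [map_neg]
    exact (hh x hx).neg

/-- The action of `𝔄_H` on `𝓞_L`, the restriction of the action of `H` on `L`. -/
def orderAction {K L : Type*} [Field K] [Field L] [Algebra K L]
    (N : Subgroup (Equiv.Perm (L ≃ₐ[K] L))) :
    associatedOrder N →+* AddMonoid.End (𝓞 L) where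
  toFun h :=
    { toFun := fun x => ⟨action N h.1 x, h.2 x x.2⟩
      map_zero' := Subtype.ext (map_zero (action N h.1))
      map_add' := fun x y => Subtype.ext (map_add (action N h.1) (x : L) (y : L)) }
  map_one' := AddMonoidHom.ext fun x => Subtype.ext <|
    show action N 1 (x : L) = x by rw [map_one]; rfl
  map_mul' h y := AddMonoidHom.ext fun x => Subtype.ext <|
    show action N (h.1 * y.1) (x : L) = action N h.1 (action N y.1 x) by rw [map_mul]; rfl
  map_zero' := AddMonoidHom.ext fun x => Subtype.ext <|
    show action N 0 (x : L) = 0 by rw [map_zero]; rfl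
  map_add' h y := AddMonoidHom.ext fun x => Subtype.ext <|
    show action N (h.1 + y.1) (x : L) = action N h.1 x + action N y.1 x by rw [map_add]; rfl

/-- `𝓞_L` as a module over `𝔄_H`. -/
instance {K L : Type*} [Field K] [Field L] [Algebra K L]
    (N : Subgroup (Equiv.Perm (L ≃ₐ[K] L))) : Module (associatedOrder N) (𝓞 L) :=
  Module.compHom (𝓞 L) (orderAction N)

open Classical in
/-- The 4-cycle `η_{T,1} = (1, στ, τ, σ)` of `Perm G`, where `T = ⟨τ⟩`. -/
def eta {G : Type*} [Group G] (σ τ : G) : Equiv.Perm G :=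
  [1, σ * τ, τ, σ].formPerm

/-- The subgroup `N_{T,1} = ⟨μ, η_{T,1}⟩` of `Perm G` attached to the subgroup `T = ⟨τ⟩` of order
two of `G = ⟨σ, τ⟩ ≅ C₂ × C₂`, where `μ = λ(τ)` is the left translation by `τ`. -/
def typeC4Subgroup {G : Type*} [Group G] (σ τ : G) : Subgroup (Equiv.Perm G) :=
  Subgroup.closure {Equiv.mulLeft τ, eta σ τ}

end

end HopfGalois

/-! Put d = gcd(m, n), m = de, n = df, so that k = ef, and let a = √m, b = √n, c = ab/d. Let s be
the root among a, b, c that corresponds to the Hopf-Galois structure H.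

If 𝓞_L is free over the associated order, then it is cyclic (`exists_generator`): the order contains
the trace, which maps 𝓞_L into ℤ, and this rules out two basis vectors. Let β be a generator.

H acts by rational scalars on the lines ℚ and ℚs. On the plane spanned by the other two roots it
acts through u + vJ with J² = -s² (`IsBiquadratic.action_eq`). For s² > 0 this is a definite
situation: the plane carries a definite quadratic form q (for s = a it is dZ² + eW²), which u + vJ
multiplies by u² + s²v². An element of the associated order preserves the projection of 𝓞_L to the
plane, so this factor is the determinant of an integer matrix. Hence q(x) is an integer multiple of
q(β) for every integral x.

Testing this on two integral elements shows that Q, a suitable multiple of q(β), satisfies Q² ∣ de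
or Q² ∣ df, which is square-free; so Q = ±1. By the description of integral elements in
`exists_int_coords`, a definite form in integers can be that small only if its coefficients are
small: `eq_one_or_eq_one` for H₁ and `abs_eq_two` for H₂. The symmetry `swap` derives H₃ from
`abs_eq_two`. -/

namespace HopfGalois

/-! ### The cyclic group N of order four and its conjugation by left translations -/

/-- `S` and `T` generate the group `G`, which is a Klein four-group. -/
structure IsKleinPair {G : Type*} [Group G] (S T : G) : Prop where
  S_mul_S : S * S = 1
  T_mul_T : T * T = 1
  T_mul_S : T * S = S * T
  S_ne_one : S ≠ 1
  T_ne_one : T ≠ 1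
  S_ne_T : S ≠ T
  eq_or : ∀ g : G, g = 1 ∨ g = S ∨ g = T ∨ g = S * T

theorem mulLeft_mul {G : Type*} [Group G] (x y : G) :
    Equiv.mulLeft (x * y) = Equiv.mulLeft x * Equiv.mulLeft y := by
  ext; simp

namespace IsKleinPair

variable {G : Type*} [Group G] {S T : G}

theorem S_mul_ST (h : IsKleinPair S T) : S * (S * T) = T := by
  rw [← mul_assoc, h.S_mul_S, one_mul]

theorem T_mul_ST (h : IsKleinPair S T) : T * (S * T) = S := by
  rw [← h.T_mul_S, ← mul_assoc, h.T_mul_T, one_mul]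

theorem T_inv (h : IsKleinPair S T) : T⁻¹ = T := inv_eq_of_mul_eq_one_left h.T_mul_T

theorem ST_ne_one (h : IsKleinPair S T) : S * T ≠ 1 := fun e =>
  h.S_ne_T (by rw [← h.T_inv]; exact eq_inv_of_mul_eq_one_left e)

theorem ST_ne_T (h : IsKleinPair S T) : S * T ≠ T := fun e => h.S_ne_one (by simpa using e)

theorem eta_one (h : IsKleinPair S T) : eta S T 1 = S * T := by
  simp [eta, List.formPerm_cons_cons, Equiv.swap_apply_def, h.S_ne_one.symm, h.T_ne_one.symm,
    h.ST_ne_one.symm]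

theorem eta_ST (h : IsKleinPair S T) : eta S T (S * T) = T := by
  simp [eta, List.formPerm_cons_cons, Equiv.swap_apply_def, h.S_ne_one, h.T_ne_one]

theorem eta_T (h : IsKleinPair S T) : eta S T T = S := by
  simp [eta, List.formPerm_cons_cons, Equiv.swap_apply_def, h.S_ne_one, h.T_ne_one,
    h.S_ne_T]

theorem eta_S (_h : IsKleinPair S T) : eta S T S = 1 := by
  simp [eta, List.formPerm_cons_cons]

theorem perm_ext (h : IsKleinPair S T) {α β : Equiv.Perm G} (h1 : α 1 = β 1) (hS : α S = β S)
    (hT : α T = β T) (hST : α (S * T) = β (S * T)) : α = β := by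
  ext g
  rcases h.eq_or g with rfl | rfl | rfl | rfl <;> assumption

theorem eta_mul_eta (h : IsKleinPair S T) : eta S T * eta S T = Equiv.mulLeft T := by
  apply h.perm_ext <;>
    simp [h.eta_one, h.eta_S, h.eta_T, h.eta_ST, h.T_mul_T, h.T_mul_S, h.T_mul_ST]

theorem mulLeft_T_mul_eta (h : IsKleinPair S T) :
    Equiv.mulLeft T * eta S T = eta S T * Equiv.mulLeft T := by
  rw [← h.eta_mul_eta, mul_assoc]

theorem mulLeft_T_mul_self (h : IsKleinPair S T) :
    Equiv.mulLeft T * Equiv.mulLeft T = 1 := by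
  rw [← mulLeft_mul, h.T_mul_T]
  ext; simp

/-- The 4-cycle has square μ, so it generates N alone, and the fourth element ημ is its inverse. -/
theorem mem_typeC4Subgroup (h : IsKleinPair S T) {α : Equiv.Perm G} :
    α ∈ typeC4Subgroup S T ↔ α = 1 ∨ α = eta S T ∨ α = Equiv.mulLeft T ∨
      α = eta S T * Equiv.mulLeft T := by
  have hμ : Equiv.mulLeft T ∈ typeC4Subgroup S T := Subgroup.subset_closure (by simp)
  have hη : eta S T ∈ typeC4Subgroup S T := Subgroup.subset_closure (by simp)
  constructor
  · intro hα
    have hpow : α ∈ Subgroup.zpowers (eta S T) := by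
      refine (Subgroup.closure_le _).2 ?_ hα
      rintro β (rfl | rfl)
      · rw [← h.eta_mul_eta]
        exact mul_mem (Subgroup.mem_zpowers _) (Subgroup.mem_zpowers _)
      · exact Subgroup.mem_zpowers _
    obtain ⟨i, rfl⟩ := Subgroup.mem_zpowers_iff.1 hpow
    have h4 : eta S T ^ (4 : ℤ) = 1 := by
      rw [show (4 : ℤ) = 1 + 1 + (1 + 1) by norm_num, zpow_add, zpow_add, zpow_one, h.eta_mul_eta,
        h.mulLeft_T_mul_self]
    have h2 : eta S T ^ (2 : ℤ) = Equiv.mulLeft T := by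
      rw [show (2 : ℤ) = 1 + 1 by norm_num, zpow_add, zpow_one, h.eta_mul_eta]
    have hi : eta S T ^ i = eta S T ^ (i % 4) := by
      conv_lhs => rw [← Int.mul_ediv_add_emod i 4, zpow_add, zpow_mul, h4, one_zpow, one_mul]
    rw [hi]
    have : i % 4 = 0 ∨ i % 4 = 1 ∨ i % 4 = 2 ∨ i % 4 = 3 := by omega
    rcases this with e | e | e | e <;> rw [e]
    · simp
    · simp
    · simp [h2]
    · rw [show (3 : ℤ) = 1 + 2 by norm_num, zpow_add, zpow_one, h2]; simp
  · rintro (rfl | rfl | rfl | rfl)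
    exacts [one_mem _, hη, hμ, mul_mem hη hμ]

theorem conj_mulLeft_T (h : IsKleinPair S T) (g : G) :
    Equiv.mulLeft g * Equiv.mulLeft T * (Equiv.mulLeft g)⁻¹ = Equiv.mulLeft T := by
  rw [mul_inv_eq_iff_eq_mul, ← mulLeft_mul, ← mulLeft_mul]
  rcases h.eq_or g with rfl | rfl | rfl | rfl
  · simp
  · rw [h.T_mul_S]
  · rfl
  · rw [h.T_mul_ST, mul_assoc, h.T_mul_T, mul_one]

/-- Translation by S reverses the cyclic order (1, ST, T, S), so it inverts η, and η⁻¹ = ημ.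
Translation by T is η² and centralises η; this fixes the whole action of G on N. -/
theorem conj_S_eta (h : IsKleinPair S T) :
    Equiv.mulLeft S * eta S T * (Equiv.mulLeft S)⁻¹ = eta S T * Equiv.mulLeft T := by
  rw [mul_inv_eq_iff_eq_mul]
  apply h.perm_ext <;>
    simp [h.eta_one, h.eta_S, h.eta_T, h.eta_ST, h.T_mul_S, h.T_mul_ST, h.S_mul_ST, h.S_mul_S,
      h.T_mul_T]

theorem conj_T_eta (h : IsKleinPair S T) :
    Equiv.mulLeft T * eta S T * (Equiv.mulLeft T)⁻¹ = eta S T := by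
  rw [mul_inv_eq_iff_eq_mul, h.mulLeft_T_mul_eta]

theorem conj_eta (h : IsKleinPair S T) (g : G) :
    Equiv.mulLeft g * eta S T * (Equiv.mulLeft g)⁻¹ = eta S T ∨
      Equiv.mulLeft g * eta S T * (Equiv.mulLeft g)⁻¹ = eta S T * Equiv.mulLeft T := by
  rcases h.eq_or g with rfl | rfl | rfl | rfl
  · left; simp
  · exact Or.inr h.conj_S_eta
  · exact Or.inl h.conj_T_eta
  · right
    rw [← h.conj_S_eta, mulLeft_mul, mul_inv_rev]
    conv_rhs => rw [← h.conj_T_eta]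
    group

theorem eta_inv_one (h : IsKleinPair S T) : (eta S T)⁻¹ 1 = S := by
  rw [Equiv.Perm.inv_eq_iff_eq, h.eta_S]

theorem mulLeft_T_inv_one (h : IsKleinPair S T) : (Equiv.mulLeft T)⁻¹ 1 = T := by
  rw [Equiv.Perm.inv_eq_iff_eq]
  exact h.T_mul_T.symm

theorem eta_mul_inv_one (h : IsKleinPair S T) : (eta S T * Equiv.mulLeft T)⁻¹ 1 = S * T := by
  rw [Equiv.Perm.inv_eq_iff_eq, Equiv.Perm.mul_apply]
  change 1 = eta S T (T * (S * T))
  rw [h.T_mul_ST, h.eta_S]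

end IsKleinPair

/-! ### Elements of L[N]^G and their action on L -/

section

variable {K L : Type*} [Field K] [Field L] [Algebra K L] {S T : L ≃ₐ[K] L}

theorem exists_eq_single_add (h : IsKleinPair S T) (y : hopfAlgebra (typeC4Subgroup S T)) :
    ∃ c₀ c₁ c₂ c₃ : L, (y : MonoidAlgebra L (Equiv.Perm (L ≃ₐ[K] L))) =
      MonoidAlgebra.single 1 c₀ + MonoidAlgebra.single (eta S T) c₁ +
      MonoidAlgebra.single (Equiv.mulLeft T) c₂ +
      MonoidAlgebra.single (eta S T * Equiv.mulLeft T) c₃ := by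
  obtain ⟨z, hz⟩ : ∃ z, MonoidAlgebra.mapDomainAlgHom K L (typeC4Subgroup S T).subtype z = y.1 :=
    y.2.1
  rw [← hz]
  clear hz
  induction z using MonoidAlgebra.induction_linear with
  | zero => exact ⟨0, 0, 0, 0, by simp⟩
  | add f g hf hg =>
    obtain ⟨a₀, a₁, a₂, a₃, ha⟩ := hf
    obtain ⟨b₀, b₁, b₂, b₃, hb⟩ := hg
    refine ⟨a₀ + b₀, a₁ + b₁, a₂ + b₂, a₃ + b₃, ?_⟩
    rw [map_add, ha, hb]
    simp only [MonoidAlgebra.single_add]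
    abel
  | single θ e =>
    have hθ := h.mem_typeC4Subgroup.1 θ.2
    rcases hθ with hθ | hθ | hθ | hθ
    · exact ⟨e, 0, 0, 0, by simp [hθ]⟩
    · exact ⟨0, e, 0, 0, by simp [hθ]⟩
    · exact ⟨0, 0, e, 0, by simp [hθ]⟩
    · exact ⟨0, 0, 0, e, by simp [hθ]⟩

theorem semilinearConj_coe (N : Subgroup (Equiv.Perm (L ≃ₐ[K] L))) (y : hopfAlgebra N)
    (g : L ≃ₐ[K] L) : semilinearConj g (y : MonoidAlgebra L (Equiv.Perm (L ≃ₐ[K] L))) = y := by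
  have := y.2.2
  rw [SetLike.mem_coe, Algebra.mem_iInf] at this
  exact this g

namespace IsKleinPair

variable {G : Type*} [Group G] {S T : G}

theorem eta_ne_one (h : IsKleinPair S T) : eta S T ≠ 1 := fun e =>
  h.ST_ne_one (by rw [← h.eta_one, e]; rfl)

theorem mulLeft_T_ne_one (h : IsKleinPair S T) : Equiv.mulLeft T ≠ 1 := fun e =>
  h.T_ne_one (by simpa using congr($e 1))

theorem eta_ne_mulLeft_T (h : IsKleinPair S T) : eta S T ≠ Equiv.mulLeft T := fun e =>
  h.ST_ne_T (by simpa [h.eta_one] using congr($e 1))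

theorem eta_mul_ne_one (h : IsKleinPair S T) : eta S T * Equiv.mulLeft T ≠ 1 := fun e =>
  h.S_ne_one (by simpa [h.eta_T] using congr($e 1))

end IsKleinPair

/-- Compare coefficients: conjugation by S exchanges η with ημ and fixes 1 and μ, while conjugation
by T fixes all of N. -/
theorem semilinearConj_coeff (h : IsKleinPair S T) {c₀ c₁ c₂ c₃ : L}
    (y : hopfAlgebra (typeC4Subgroup S T))
    (hy : (y : MonoidAlgebra L (Equiv.Perm (L ≃ₐ[K] L))) =
      MonoidAlgebra.single 1 c₀ + MonoidAlgebra.single (eta S T) c₁ +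
      MonoidAlgebra.single (Equiv.mulLeft T) c₂ +
      MonoidAlgebra.single (eta S T * Equiv.mulLeft T) c₃) :
    S c₀ = c₀ ∧ T c₀ = c₀ ∧ S c₂ = c₂ ∧ T c₂ = c₂ ∧ T c₁ = c₁ ∧ c₃ = S c₁ := by
  classical
  have hS := semilinearConj_coe _ y S
  have hT := semilinearConj_coe _ y T
  have h1 : Equiv.mulLeft S * (eta S T * Equiv.mulLeft T) * (Equiv.mulLeft S)⁻¹ = eta S T := by
    have := h.conj_S_eta
    have h2 := h.conj_mulLeft_T S
    rw [mul_inv_eq_iff_eq_mul] at this h2 ⊢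
    rw [← mul_assoc, this, mul_assoc, h2, ← mul_assoc, mul_assoc (eta S T), h.mulLeft_T_mul_self,
      mul_one]
  have h2 : Equiv.mulLeft T * (eta S T * Equiv.mulLeft T) * (Equiv.mulLeft T)⁻¹ =
      eta S T * Equiv.mulLeft T := by
    rw [← mul_assoc, h.mulLeft_T_mul_eta, mul_assoc, mul_assoc, mul_inv_cancel, mul_one]
  rw [hy] at hS hT
  simp only [map_add, semilinearConj_single, h.conj_S_eta, h1, h.conj_mulLeft_T, mul_one,
    mul_inv_cancel] at hS
  simp only [map_add, semilinearConj_single, h.conj_T_eta, h2, h.conj_mulLeft_T, mul_one,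
    mul_inv_cancel] at hT
  have e1 := h.eta_ne_one
  have e2 := h.mulLeft_T_ne_one
  have e3 := h.eta_ne_mulLeft_T
  have e4 := h.eta_mul_ne_one
  have hS₀ := congr(($hS).coeff 1)
  have hS₂ := congr(($hS).coeff (Equiv.mulLeft T))
  have hS₃ := congr(($hS).coeff (eta S T * Equiv.mulLeft T))
  have hT₀ := congr(($hT).coeff 1)
  have hT₁ := congr(($hT).coeff (eta S T))
  have hT₂ := congr(($hT).coeff (Equiv.mulLeft T))
  simp [e1, e2, e3, e4, e1.symm, e2.symm, e3.symm, e4.symm]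
    at hS₀ hS₂ hS₃ hT₀ hT₁ hT₂
  exact ⟨hS₀, hT₀, hS₂, hT₂, hT₁, hS₃.symm⟩

theorem action_apply (h : IsKleinPair S T) {c₀ c₁ c₂ c₃ : L}
    (y : hopfAlgebra (typeC4Subgroup S T))
    (hy : (y : MonoidAlgebra L (Equiv.Perm (L ≃ₐ[K] L))) =
      MonoidAlgebra.single 1 c₀ + MonoidAlgebra.single (eta S T) c₁ +
      MonoidAlgebra.single (Equiv.mulLeft T) c₂ +
      MonoidAlgebra.single (eta S T * Equiv.mulLeft T) c₃) (x : L) :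
    action _ y x = c₀ * x + c₁ * S x + c₂ * T x + c₃ * S (T x) := by
  change actionMap K L (y : MonoidAlgebra L (Equiv.Perm (L ≃ₐ[K] L))) x = _
  rw [hy]
  simp only [map_add, LinearMap.add_apply, actionMap_single, h.eta_inv_one, h.mulLeft_T_inv_one,
    h.eta_mul_inv_one]
  simp

/-- The sum of all elements of N is G-invariant because conjugation permutes N; it acts as the trace
of L. -/
theorem exists_trace (h : IsKleinPair S T) : ∃ t : hopfAlgebra (typeC4Subgroup S T),
    ∀ x, action _ t x = x + S x + T x + S (T x) := by
  have hmem : MonoidAlgebra.single 1 1 + MonoidAlgebra.single (eta S T) 1 +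
      MonoidAlgebra.single (Equiv.mulLeft T) 1 +
      MonoidAlgebra.single (eta S T * Equiv.mulLeft T) (1 : L) ∈
      hopfAlgebra (typeC4Subgroup S T) := by
    have hs : ∀ θ ∈ typeC4Subgroup S T, MonoidAlgebra.single θ (1 : L) ∈
        (MonoidAlgebra.mapDomainAlgHom K L (typeC4Subgroup S T).subtype).range := by
      intro θ hθ
      exact ⟨MonoidAlgebra.single ⟨θ, hθ⟩ 1, by simp⟩
    refine ⟨?_, ?_⟩
    · refine add_mem (add_mem (add_mem ?_ ?_) ?_) ?_ <;> refine hs _ (h.mem_typeC4Subgroup.2 ?_) <;>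
        simp
    · rw [SetLike.mem_coe, Algebra.mem_iInf]
      intro g
      rw [AlgHom.mem_equalizer, AlgHom.id_apply]
      have hg : Equiv.mulLeft g * (eta S T * Equiv.mulLeft T) * (Equiv.mulLeft g)⁻¹ =
          (Equiv.mulLeft g * eta S T * (Equiv.mulLeft g)⁻¹) *
          (Equiv.mulLeft g * Equiv.mulLeft T * (Equiv.mulLeft g)⁻¹) := by group
      simp only [map_add, semilinearConj_single, mul_one, mul_inv_cancel, map_one, hg,
        h.conj_mulLeft_T]
      rcases h.conj_eta g with e | e <;> rw [e]
      rw [mul_assoc, h.mulLeft_T_mul_self, mul_one]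
      abel
  refine ⟨⟨_, hmem⟩, fun x => ?_⟩
  rw [action_apply h (⟨_, hmem⟩ : hopfAlgebra (typeC4Subgroup S T)) rfl]
  simp

end

/-! ### The action in coordinates, and a generator from freeness -/

/-- `L = ℚ(s, p)` with `s²` and `p²` rational, and `S`, `T` change the sign of `s`, respectively
of `p`, only. -/
structure IsBiquadratic {L : Type*} [Field L] [CharZero L] (s p : L) (S T : L ≃ₐ[ℚ] L) :
    Prop where
  S_s : S s = -s
  S_p : S p = p
  T_s : T s = s
  T_p : T p = -p
  s_ne : s ≠ 0
  p_ne : p ≠ 0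
  sq_s : ∃ r : ℚ, s ^ 2 = r
  sq_p : ∃ r : ℚ, p ^ 2 = r
  exists_repr : ∀ z : L, ∃ x y u v : ℚ, z = x + y * s + u * p + v * (s * p)

namespace IsBiquadratic

variable {L : Type*} [Field L] [CharZero L] {s p : L} {S T : L ≃ₐ[ℚ] L}

theorem algEquiv_ext (h : IsBiquadratic s p S T) {g g' : L ≃ₐ[ℚ] L} (hs : g s = g' s)
    (hp : g p = g' p) : g = g' := by
  ext z
  obtain ⟨x, y, u, v, rfl⟩ := h.exists_repr z
  simp [hs, hp]

theorem apply_eq_or_neg {x : L} (hx : ∃ r : ℚ, x ^ 2 = r) (g : L ≃ₐ[ℚ] L) :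
    g x = x ∨ g x = -x := by
  obtain ⟨r, hr⟩ := hx
  apply sq_eq_sq_iff_eq_or_eq_neg.1
  rw [← map_pow, hr, map_ratCast]

theorem isKleinPair (h : IsBiquadratic s p S T) : IsKleinPair S T where
  S_mul_S := h.algEquiv_ext (by simp [h.S_s]) (by simp [h.S_p])
  T_mul_T := h.algEquiv_ext (by simp [h.T_s]) (by simp [h.T_p])
  T_mul_S := h.algEquiv_ext (by simp [h.S_s, h.T_s]) (by simp [h.T_p, h.S_p])
  S_ne_one e := self_ne_neg.2 h.s_ne (by rw [← h.S_s, e]; rfl)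
  T_ne_one e := self_ne_neg.2 h.p_ne (by rw [← h.T_p, e]; rfl)
  S_ne_T e := self_ne_neg.2 h.s_ne (by rw [← h.S_s, e, h.T_s])
  eq_or g := by
    rcases apply_eq_or_neg h.sq_s g with hs | hs <;> rcases apply_eq_or_neg h.sq_p g with hp | hp
    · exact Or.inl (h.algEquiv_ext hs hp)
    · exact Or.inr (Or.inr (Or.inl (h.algEquiv_ext (by rw [hs, h.T_s]) (by rw [hp, h.T_p]))))
    · exact Or.inr (Or.inl (h.algEquiv_ext (by rw [hs, h.S_s]) (by rw [hp, h.S_p])))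
    · exact Or.inr (Or.inr (Or.inr (h.algEquiv_ext (by simp [hs, h.T_s, h.S_s])
        (by simp [hp, h.T_p, h.S_p]))))

theorem exists_ratCast_of_fixed (h : IsBiquadratic s p S T) {z : L} (hS : S z = z) (hT : T z = z) :
    ∃ r : ℚ, z = r := by
  obtain ⟨x, y, u, v, hz⟩ := h.exists_repr z
  refine ⟨x, ?_⟩
  have e1 := hS
  have e2 := hT
  rw [hz] at e1 e2
  simp only [map_add, map_mul, map_ratCast, h.S_s, h.S_p, h.T_s, h.T_p] at e1 e2
  rw [hz]
  have e3 : (2 : L) * (y * s + v * (s * p)) = 0 := by linear_combination -e1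
  have e4 : (2 : L) * (u * p + v * (s * p)) = 0 := by linear_combination -e2
  have h2 : (2 : L) ≠ 0 := two_ne_zero
  have e5 := (mul_eq_zero.1 e3).resolve_left h2
  have e6 := (mul_eq_zero.1 e4).resolve_left h2
  -- T changes the sign of the `s * p` term only, which separates the two terms.
  have e7 := congr(T $e5)
  simp only [map_add, map_mul, map_ratCast, h.T_s, h.T_p, map_zero] at e7
  have e8 : (2 : L) * (y * s) = 0 := by linear_combination e5 + e7
  have e9 := (mul_eq_zero.1 e8).resolve_left h2
  linear_combination e9 + e6

/-- The coefficients c₀, c₂ are rational, c₁ lies in ℚ(s), and c₃ is its conjugate. So c₁ + c₃ is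
rational and c₁ - c₃ is a rational multiple vs. On p the element acts as (c₀ - c₂) + (c₁ - c₃), on
sp as (c₀ - c₂) - (c₁ - c₃); the opposite signs make J² = -s². -/
theorem action_eq (h : IsBiquadratic s p S T) (y : hopfAlgebra (typeC4Subgroup S T)) :
    ∃ x₀ x₁ u v : ℚ, action _ y 1 = x₀ ∧ action _ y s = x₁ * s ∧
      action _ y p = u * p + v * (s * p) ∧
      ∀ q, S q = -q → T q = -q → action _ y q = u * q - v * (s * q) := by
  obtain ⟨c₀, c₁, c₂, c₃, hy⟩ := exists_eq_single_add h.isKleinPair y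
  obtain ⟨hS₀, hT₀, hS₂, hT₂, hT₁, rfl⟩ := semilinearConj_coeff h.isKleinPair y hy
  have hSS : S (S c₁) = c₁ := congr($(h.isKleinPair.S_mul_S) c₁)
  have hTS : T (S c₁) = S c₁ := by
    rw [show T (S c₁) = S (T c₁) from congr($(h.isKleinPair.T_mul_S) c₁), hT₁]
  obtain ⟨x₀, hx₀⟩ := h.exists_ratCast_of_fixed (z := c₀ + c₂ + (c₁ + S c₁))
    (by simp only [map_add, hS₀, hS₂, hSS]; ring) (by simp only [map_add, hT₀, hT₂, hT₁, hTS])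
  obtain ⟨x₁, hx₁⟩ := h.exists_ratCast_of_fixed (z := c₀ + c₂ - (c₁ + S c₁))
    (by simp only [map_add, map_sub, hS₀, hS₂, hSS]; ring)
    (by simp only [map_add, map_sub, hT₀, hT₂, hT₁, hTS])
  obtain ⟨u, hu⟩ := h.exists_ratCast_of_fixed (z := c₀ - c₂)
    (by simp only [map_sub, hS₀, hS₂]) (by simp only [map_sub, hT₀, hT₂])
  obtain ⟨v, hv⟩ := h.exists_ratCast_of_fixed (z := (c₁ - S c₁) / s)
    (by simp only [map_sub, map_div₀, hSS, h.S_s]; rw [div_neg, ← neg_div]; ring)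
    (by simp only [map_sub, map_div₀, hT₁, hTS, h.T_s])
  rw [div_eq_iff h.s_ne] at hv
  refine ⟨x₀, x₁, u, v, ?_, ?_, ?_, fun q hSq hTq => ?_⟩ <;>
    rw [action_apply h.isKleinPair y hy]
  · simp only [map_one]; linear_combination hx₀
  · simp only [h.T_s, h.S_s]; linear_combination s * hx₁
  · simp only [h.T_p, h.S_p, map_neg]; linear_combination p * hu + p * hv
  · simp only [hSq, hTq, map_neg]; linear_combination q * hu - q * hv

theorem isIntegral_apply {x : L} (hx : IsIntegral ℤ x) (g : L ≃ₐ[ℚ] L) : IsIntegral ℤ (g x) :=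
  hx.map (g.toAlgHom.restrictScalars ℤ)

theorem coe_smul [NumberField L] {N : Subgroup (Equiv.Perm (L ≃ₐ[ℚ] L))} 
    (y : associatedOrder N) (x : 𝓞 L) :
    ((y • x : 𝓞 L) : L) = action N y.1 x := rfl

/-- The trace t sends each basis vector to an integer. For two basis vectors these integers give a
linear relation over the order, which contradicts independence because t·1 = 4 ≠ 0. -/
theorem exists_generator [NumberField L] (h : IsBiquadratic s p S T)
    [Module.Free (associatedOrder (typeC4Subgroup S T)) (𝓞 L)] :
    ∃ β : L, IsIntegral ℤ β ∧ ∀ x : L, IsIntegral ℤ x → ∃ y : hopfAlgebra (typeC4Subgroup S T),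
      y ∈ associatedOrder (typeC4Subgroup S T) ∧ action _ y β = x := by
  have hK := h.isKleinPair
  obtain ⟨t, ht⟩ := exists_trace hK
  have htA : t ∈ associatedOrder (typeC4Subgroup S T) := fun x hx => by
    rw [ht]
    exact ((hx.add (isIntegral_apply hx S)).add (isIntegral_apply hx T)).add
      (isIntegral_apply (isIntegral_apply hx T) S)
  have hSS (x : L) : S (S x) = x := congr($(hK.S_mul_S) x)
  have hTT (x : L) : T (T x) = x := congr($(hK.T_mul_T) x)
  have hTS (x : L) : T (S x) = S (T x) := congr($(hK.T_mul_S) x)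
  set t' : associatedOrder (typeC4Subgroup S T) := ⟨t, htA⟩ with ht'
  have htint (x : 𝓞 L) : ∃ n : ℤ, t' • x = (n : 𝓞 L) := by
    have hx : IsIntegral ℤ ((t' • x : 𝓞 L) : L) := (t' • x).2
    have hx' := coe_smul t' x
    rw [ht', ht] at hx'
    obtain ⟨r, hr⟩ := h.exists_ratCast_of_fixed (z := ((t' • x : 𝓞 L) : L))
      (by rw [hx']; simp only [map_add, hSS]; ring)
      (by rw [hx']; simp only [map_add, hTS, hTT]; ring)
    rw [hr] at hx
    obtain ⟨n, hn⟩ := IsIntegrallyClosed.isIntegral_iff.1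
      ((isIntegral_algebraMap_iff (A := ℚ) (B := L) (algebraMap ℚ L).injective).1 hx)
    refine ⟨n, NumberField.RingOfIntegers.ext ?_⟩
    rw [hr, ← hn]
    simp
  have htn (n : ℤ) : t' • (n : 𝓞 L) = ((4 * n : ℤ) : 𝓞 L) := by
    refine NumberField.RingOfIntegers.ext ?_
    rw [coe_smul, ht', ht]
    have hc (k : ℤ) : ((k : 𝓞 L) : L) = k := map_intCast (algebraMap (𝓞 L) L) k
    simp only [hc, map_intCast]
    push_cast
    ring
  let B := Module.Free.chooseBasis (associatedOrder (typeC4Subgroup S T)) (𝓞 L)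
  set ι := Module.Free.ChooseBasisIndex (associatedOrder (typeC4Subgroup S T)) (𝓞 L)
  have htne : t' ≠ 0 := fun e => by
    have := htn 1
    rw [e, zero_smul] at this
    exact absurd this (by norm_num)
  have hsub : Subsingleton ι := by
    constructor
    intro i j
    by_contra hij
    obtain ⟨m, hm⟩ := htint (B i)
    obtain ⟨n, hn⟩ := htint (B j)
    -- Both sides equal the integer nm.
    have key : ((n : associatedOrder (typeC4Subgroup S T)) * t') • B i =
        ((m : associatedOrder (typeC4Subgroup S T)) * t') • B j := by
      rw [mul_smul, mul_smul, hm, hn, Int.cast_smul_eq_zsmul, Int.cast_smul_eq_zsmul,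
        zsmul_eq_mul, zsmul_eq_mul, mul_comm]
    have key' := congr(B.repr $key i)
    simp only [map_smul, Module.Basis.repr_self, Finsupp.smul_apply, Finsupp.single_eq_same,
      Finsupp.single_eq_of_ne hij, smul_eq_mul, mul_one, mul_zero] at key'
    have hn0 : n = 0 := by
      have := htn 1
      have h2 : ((n : associatedOrder (typeC4Subgroup S T)) * t') • ((1 : ℤ) : 𝓞 L) = 0 := by
        rw [key', zero_smul]
      rw [mul_smul, this, Int.cast_smul_eq_zsmul, zsmul_eq_mul] at h2
      simpa using h2
    rw [hn0, Int.cast_zero] at hn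
    have := congr(B.repr $hn j)
    simp only [map_smul, Module.Basis.repr_self, Finsupp.smul_apply, Finsupp.single_eq_same,
      smul_eq_mul, mul_one, map_zero, Finsupp.coe_zero, Pi.zero_apply] at this
    exact htne this
  have hne : Nonempty ι := by
    by_contra hemp
    rw [not_nonempty_iff] at hemp
    have := B.repr.toEquiv.subsingleton
    exact one_ne_zero (Subsingleton.elim (1 : 𝓞 L) 0)
  obtain ⟨i⟩ := hne
  let _ : Unique ι := ⟨⟨i⟩, fun j => Subsingleton.elim j i⟩
  refine ⟨B i, (B i).isIntegral_coe, fun x hx => ?_⟩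
  have hrep := B.sum_repr ⟨x, hx⟩
  rw [Fintype.sum_unique, show (default : ι) = i from rfl] at hrep
  refine ⟨(B.repr ⟨x, hx⟩ i).1, (B.repr ⟨x, hx⟩ i).2, ?_⟩
  exact congrArg (fun z : 𝓞 L => (z : L)) hrep

end IsBiquadratic

/-! ### Integral elements of the biquadratic field -/

/-- `a = √(de)`, `b = √(df)`, `c = √(ef)` generate the biquadratic field `L`, where `de`, `df`, `ef`
are square-free, `de ≡ 3` and `f ≡ 2 (mod 4)`; `σ` and `τ` are the automorphisms fixing `b`,
respectively `a`. -/
structure SqrtTriple {L : Type*} [Field L] [CharZero L] (d e f : ℤ) (a b c : L)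
    (σ τ : L ≃ₐ[ℚ] L) : Prop where
  squarefree_de : Squarefree (d * e)
  squarefree_df : Squarefree (d * f)
  squarefree_ef : Squarefree (e * f)
  de_mod : d * e % 4 = 3
  f_mod : f % 4 = 2
  a_sq : a ^ 2 = d * e
  b_sq : b ^ 2 = d * f
  c_sq : c ^ 2 = e * f
  a_mul_b : a * b = d * c
  a_mul_c : a * c = e * b
  b_mul_c : b * c = f * a
  σ_a : σ a = -a
  σ_b : σ b = b
  σ_c : σ c = -c
  τ_a : τ a = a
  τ_b : τ b = -b
  τ_c : τ c = -c
  exists_repr : ∀ z : L, ∃ X Y Z W : ℚ, z = X + Y * a + Z * b + W * c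

/-- The square of the denominator of q divides m. -/
theorem exists_intCast_of_mul_sq {m : ℤ} (hm : Squarefree m) {q : ℚ} {r : ℤ}
    (h : m * q ^ 2 = r) : ∃ t : ℤ, q = t := by
  have hq : (q.den : ℚ) ≠ 0 := by exact_mod_cast q.den_ne_zero
  have h1 : (m : ℚ) * q.num ^ 2 = r * (q.den : ℚ) ^ 2 := by
    rw [← h]
    conv_rhs => rw [← Rat.num_div_den q]
    field_simp
    simp [Rat.num_div_den]
  have h2 : m * q.num ^ 2 = r * (q.den : ℤ) ^ 2 := by exact_mod_cast h1
  have hcop : IsCoprime ((q.den : ℤ) ^ 2) (q.num ^ 2) := by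
    have := Rat.isCoprime_num_den q
    exact this.symm.pow
  have h3 : (q.den : ℤ) * q.den ∣ m := by
    rw [← sq]
    exact hcop.dvd_of_dvd_mul_right (Dvd.intro_left _ h2.symm)
  have h4 := Int.isUnit_iff.1 (hm _ h3)
  have h5 : q.den = 1 := by omega
  exact ⟨q.num, (Rat.coe_int_num_of_den_eq_one h5).symm⟩

section

variable {L : Type*} [Field L] [CharZero L]

theorem exists_intCast_of_isIntegral {r : ℚ} (h : IsIntegral ℤ (r : L)) : ∃ n : ℤ, r = n := by
  have h' : IsIntegral ℤ (algebraMap ℚ L r) := by simpa using h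
  obtain ⟨n, hn⟩ := IsIntegrallyClosed.isIntegral_iff.1
    ((isIntegral_algebraMap_iff (algebraMap ℚ L).injective).1 h')
  exact ⟨n, by simpa using hn.symm⟩

/-- Trace and norm make R = 2r and T = 2t integers with R² ≡ mT² (mod 4); for m ≡ 2, 3 this forces
both to be even. -/
theorem exists_int_of_isIntegral_add_mul_sqrt {m : ℤ} (hm : Squarefree m)
    (hm4 : m % 4 = 2 ∨ m % 4 = 3) {a : L} (ha : a ^ 2 = m) {g : L ≃ₐ[ℚ] L} (hg : g a = -a)
    {r t : ℚ} (h : IsIntegral ℤ (r + t * a : L)) : (∃ n : ℤ, r = n) ∧ ∃ n : ℤ, t = n := by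
  have hgi := IsBiquadratic.isIntegral_apply h g
  simp only [map_add, map_mul, map_ratCast, hg] at hgi
  obtain ⟨R, hR⟩ := exists_intCast_of_isIntegral (L := L) (r := 2 * r) (by
    refine (congrArg (IsIntegral ℤ) ?_).mp (h.add hgi)
    push_cast
    ring)
  obtain ⟨P, hP⟩ := exists_intCast_of_isIntegral (L := L) (r := r ^ 2 - m * t ^ 2) (by
    refine (congrArg (IsIntegral ℤ) ?_).mp (h.mul hgi)
    push_cast
    rw [← ha]
    ring)
  obtain ⟨T, hT⟩ := exists_intCast_of_mul_sq hm (q := 2 * t) (r := R ^ 2 - 4 * P) (by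
    push_cast
    rw [← hR, ← hP]
    ring)
  have key : m * T ^ 2 = R ^ 2 - 4 * P := by
    have : (m : ℚ) * T ^ 2 = R ^ 2 - 4 * P := by
      rw [← hR, ← hP, ← hT]
      ring
    exact_mod_cast this
  have hdvd : (4 : ℤ) ∣ R ^ 2 - m * T ^ 2 := ⟨P, by linarith⟩
  have hpar : R % 2 = 0 ∧ T % 2 = 0 := by
    rcases Int.emod_two_eq_zero_or_one R with hR2 | hR2 <;>
    rcases Int.emod_two_eq_zero_or_one T with hT2 | hT2
    · exact ⟨hR2, hT2⟩
    all_goals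
      exfalso
      obtain ⟨j, hj⟩ : ∃ j, R = 2 * j + R % 2 := ⟨R / 2, by omega⟩
      obtain ⟨k, hk⟩ : ∃ k, T = 2 * k + T % 2 := ⟨T / 2, by omega⟩
      rw [hR2] at hj
      rw [hT2] at hk
      rw [hj, hk] at key
      ring_nf at key
      -- With the nonlinear terms named, a linear congruence modulo 4 remains.
      generalize m * k = x at key
      generalize m * k ^ 2 = y at key
      generalize j ^ 2 = z at key
      omega
  obtain ⟨j, hj⟩ : ∃ j, R = 2 * j := ⟨R / 2, by omega⟩
  obtain ⟨k, hk⟩ : ∃ k, T = 2 * k := ⟨T / 2, by omega⟩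
  rw [hj] at hR
  rw [hk] at hT
  push_cast at hR hT
  exact ⟨⟨j, by linarith⟩, ⟨k, by linarith⟩⟩

end

namespace SqrtTriple

variable {L : Type*} [Field L] [CharZero L] {d e f : ℤ} {a b c : L} {σ τ : L ≃ₐ[ℚ] L}

theorem odd_d (h : SqrtTriple d e f a b c σ τ) : Odd d := by
  have : Odd (d * e) := Int.odd_iff.2 (by have := h.de_mod; omega)
  exact (Int.odd_mul.1 this).1

theorem odd_e (h : SqrtTriple d e f a b c σ τ) : Odd e := by
  have : Odd (d * e) := Int.odd_iff.2 (by have := h.de_mod; omega)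
  exact (Int.odd_mul.1 this).2

theorem four_dvd_add (h : SqrtTriple d e f a b c σ τ) : 4 ∣ d + e := by
  have h1 := h.de_mod
  rw [Int.mul_emod] at h1
  have hd : d % 4 = 0 ∨ d % 4 = 1 ∨ d % 4 = 2 ∨ d % 4 = 3 := by omega
  have he : e % 4 = 0 ∨ e % 4 = 1 ∨ e % 4 = 2 ∨ e % 4 = 3 := by omega
  rcases hd with hd | hd | hd | hd <;> rcases he with he | he | he | he <;>
    rw [hd, he] at h1 <;> omega

theorem mul_f_mod {d f : ℤ} (hd : Odd d) (hf : f % 4 = 2) : d * f % 4 = 2 := by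
  obtain ⟨k, rfl⟩ := hd
  obtain ⟨l, hl⟩ : ∃ l, f = 4 * l + 2 := ⟨f / 4, by omega⟩
  rw [hl, show (2 * k + 1) * (4 * l + 2) = 4 * (2 * k * l + l + k) + 2 by ring]
  omega

theorem d_ne (h : SqrtTriple d e f a b c σ τ) : d ≠ 0 := by
  rintro rfl
  simpa using h.de_mod

theorem e_ne (h : SqrtTriple d e f a b c σ τ) : e ≠ 0 := by
  rintro rfl
  simpa using h.de_mod

theorem f_ne (h : SqrtTriple d e f a b c σ τ) : f ≠ 0 := by
  rintro rfl
  simpa using h.f_mod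

theorem a_ne (h : SqrtTriple d e f a b c σ τ) : a ≠ 0 := by
  rintro rfl
  simpa [h.d_ne, h.e_ne] using h.a_sq

theorem b_ne (h : SqrtTriple d e f a b c σ τ) : b ≠ 0 := by
  rintro rfl
  simpa [h.d_ne, h.f_ne] using h.b_sq

theorem c_ne (h : SqrtTriple d e f a b c σ τ) : c ≠ 0 := by
  rintro rfl
  simpa [h.e_ne, h.f_ne] using h.c_sq

/-- The roles of b and c are symmetric under d ↔ e; the automorphism fixing c is στ. -/
theorem swap (h : SqrtTriple d e f a b c σ τ) : SqrtTriple e d f a c b (σ * τ) τ where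
  squarefree_de := mul_comm d e ▸ h.squarefree_de
  squarefree_df := h.squarefree_ef
  squarefree_ef := h.squarefree_df
  de_mod := mul_comm d e ▸ h.de_mod
  f_mod := h.f_mod
  a_sq := by rw [h.a_sq, mul_comm]
  b_sq := h.c_sq
  c_sq := h.b_sq
  a_mul_b := h.a_mul_c
  a_mul_c := h.a_mul_b
  b_mul_c := by rw [mul_comm, h.b_mul_c]
  σ_a := by simp [h.τ_a, h.σ_a]
  σ_b := by simp [h.τ_c, h.σ_c]
  σ_c := by simp [h.τ_b, h.σ_b]
  τ_a := h.τ_a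
  τ_b := h.τ_c
  τ_c := h.τ_b
  exists_repr z := by
    obtain ⟨X, Y, Z, W, rfl⟩ := h.exists_repr z
    exact ⟨X, Y, W, Z, by ring⟩

/-- Signed sums of the four conjugates isolate the coordinates. -/
theorem coord_eq_zero (h : SqrtTriple d e f a b c σ τ) {X Y Z W : ℚ}
    (h0 : X + Y * a + Z * b + W * c = 0) : X = 0 ∧ Y = 0 ∧ Z = 0 ∧ W = 0 := by
  have h1 := congr(σ $h0)
  have h2 := congr(τ $h0)
  have h3 := congr(σ (τ $h0))
  simp only [map_add, map_mul, map_ratCast, h.σ_a, h.σ_b, h.σ_c, h.τ_a, h.τ_b, h.τ_c, map_zero,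
    map_neg] at h1 h2 h3
  have hX : (4 : L) * X = 0 := by linear_combination h0 + h1 + h2 + h3
  have hY : (4 : L) * (Y * a) = 0 := by linear_combination h0 - h1 + h2 - h3
  have hZ : (4 : L) * (Z * b) = 0 := by linear_combination h0 + h1 - h2 - h3
  have hW : (4 : L) * (W * c) = 0 := by linear_combination h0 - h1 - h2 + h3
  simpa [h.a_ne, h.b_ne, h.c_ne] using And.intro hX (And.intro hY (And.intro hZ hW))

theorem coord_ext (h : SqrtTriple d e f a b c σ τ) {X Y Z W X' Y' Z' W' : ℚ}
    (h0 : (X + Y * a + Z * b + W * c : L) = X' + Y' * a + Z' * b + W' * c) :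
    X = X' ∧ Y = Y' ∧ Z = Z' ∧ W = W' := by
  obtain ⟨h1, h2, h3, h4⟩ := h.coord_eq_zero (X := X - X') (Y := Y - Y') (Z := Z - Z')
    (W := W - W') (by push_cast; linear_combination h0)
  exact ⟨sub_eq_zero.1 h1, sub_eq_zero.1 h2, sub_eq_zero.1 h3, sub_eq_zero.1 h4⟩

/-- Traces to the three quadratic subfields make the doubled coordinates integers; the relative norm
to ℚ(a) supplies the parity conditions. -/
theorem exists_int_coords (h : SqrtTriple d e f a b c σ τ) {X Y Z W : ℚ}
    (hz : IsIntegral ℤ (X + Y * a + Z * b + W * c : L)) :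
    ∃ x y z w : ℤ, X = x ∧ Y = y ∧ 2 * Z = z ∧ 2 * W = w ∧ (Even z ↔ Even w) := by
  have hσ := IsBiquadratic.isIntegral_apply hz σ
  have hτ := IsBiquadratic.isIntegral_apply hz τ
  have hστ := IsBiquadratic.isIntegral_apply (IsBiquadratic.isIntegral_apply hz τ) σ
  simp only [map_add, map_mul, map_ratCast, h.σ_a, h.σ_b, h.σ_c, h.τ_a, h.τ_b, h.τ_c,
    map_neg] at hσ hτ hστ
  have ha := h.a_sq
  have hb := h.b_sq
  have hc := h.c_sq
  have ha' : a ^ 2 = (d * e : ℤ) := by rw [ha]; push_cast; rfl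
  have hb' : b ^ 2 = (d * f : ℤ) := by rw [hb]; push_cast; rfl
  have hc' : c ^ 2 = (e * f : ℤ) := by rw [hc]; push_cast; rfl
  obtain ⟨⟨x, hx⟩, y, hy⟩ := exists_int_of_isIntegral_add_mul_sqrt h.squarefree_de
    (Or.inr h.de_mod) ha' h.σ_a (r := 2 * X) (t := 2 * Y) (by
      refine (congrArg (IsIntegral ℤ) ?_).mp (hz.add hτ); push_cast; ring)
  obtain ⟨-, z, hz2⟩ := exists_int_of_isIntegral_add_mul_sqrt h.squarefree_df
    (Or.inl (mul_f_mod h.odd_d h.f_mod)) hb' h.τ_b (r := 2 * X) (t := 2 * Z) (by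
      refine (congrArg (IsIntegral ℤ) ?_).mp (hz.add hσ); push_cast; ring)
  obtain ⟨-, w, hw⟩ := exists_int_of_isIntegral_add_mul_sqrt h.squarefree_ef
    (Or.inl (mul_f_mod h.odd_e h.f_mod)) hc' h.τ_c (r := 2 * X) (t := 2 * W) (by
      refine (congrArg (IsIntegral ℤ) ?_).mp (hz.add hστ); push_cast; ring)
  -- These are the coordinates of the relative norm z·τ(z) in ℚ(a).
  obtain ⟨⟨P, hP⟩, Q, hQ⟩ := exists_int_of_isIntegral_add_mul_sqrt h.squarefree_de
    (Or.inr h.de_mod) ha' h.σ_a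
    (r := X ^ 2 + d * e * Y ^ 2 - d * f * Z ^ 2 - e * f * W ^ 2) (t := 2 * X * Y - 2 * f * Z * W)
    (by
      refine (congrArg (IsIntegral ℤ) ?_).mp (hz.mul hτ)
      push_cast
      linear_combination (Y : L) ^ 2 * ha - (Z : L) ^ 2 * hb - (W : L) ^ 2 * hc -
        2 * Z * W * h.b_mul_c)
  obtain ⟨g, hg⟩ : ∃ g, f = 2 * (2 * g + 1) := ⟨f / 4, by have := h.f_mod; omega⟩
  have e1 : x ^ 2 + d * e * y ^ 2 = 2 * (2 * P + d * (2 * g + 1) * z ^ 2 +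
      e * (2 * g + 1) * w ^ 2) := by
    have : (x : ℚ) ^ 2 + d * e * y ^ 2 = 2 * (2 * P + d * (2 * g + 1) * z ^ 2 +
      e * (2 * g + 1) * w ^ 2) := by
      rw [← hx, ← hy, ← hz2, ← hw, ← hP, hg]
      push_cast
      ring
    exact_mod_cast this
  have e2 : x * y = 2 * (Q + (2 * g + 1) * z * w) := by
    have : (x : ℚ) * y = 2 * (Q + (2 * g + 1) * z * w) := by
      rw [← hx, ← hy, ← hz2, ← hw, ← hQ, hg]
      push_cast
      ring
    exact_mod_cast this
  have hdo := Int.not_even_iff_odd.2 h.odd_d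
  have heo := Int.not_even_iff_odd.2 h.odd_e
  have p1 : Even (x ^ 2 + d * e * y ^ 2) := e1 ▸ even_two_mul _
  have p2 : Even (x * y) := e2 ▸ even_two_mul _
  simp only [Int.even_add, Int.even_mul, Int.even_pow, hdo, heo] at p1 p2
  have hxe : Even x := by tauto
  have hye : Even y := by tauto
  obtain ⟨x', rfl⟩ := hxe
  obtain ⟨y', rfl⟩ := hye
  have p3 : Even (d * (2 * g + 1) * z ^ 2 + e * (2 * g + 1) * w ^ 2) :=
    ⟨x' ^ 2 + d * e * y' ^ 2 - P, by linarith⟩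
  have hgo := Int.not_even_iff_odd.2 (odd_two_mul_add_one g)
  simp only [Int.even_add, Int.even_mul, Int.even_pow, hdo, heo] at p3
  refine ⟨x', y', z, w, ?_, ?_, hz2, hw, ?_⟩
  · push_cast at hx; linarith
  · push_cast at hy; linarith
  · simpa using p3

theorem isIntegral_a (h : SqrtTriple d e f a b c σ τ) : IsIntegral ℤ a := by
  refine IsIntegral.of_pow two_pos ?_
  rw [h.a_sq]
  exact_mod_cast isIntegral_algebraMap (R := ℤ) (A := L) (x := d * e)

theorem isIntegral_b (h : SqrtTriple d e f a b c σ τ) : IsIntegral ℤ b := by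
  refine IsIntegral.of_pow two_pos ?_
  rw [h.b_sq]
  exact_mod_cast isIntegral_algebraMap (R := ℤ) (A := L) (x := d * f)

/-- The square is f(d + e)/4 + (f/2)a, which is integral because 4 ∣ d + e and f is even. -/
theorem isIntegral_half (h : SqrtTriple d e f a b c σ τ) : IsIntegral ℤ ((b + c) / 2) := by
  refine IsIntegral.of_pow two_pos ?_
  obtain ⟨k, hk⟩ := h.four_dvd_add
  obtain ⟨g, hg⟩ : ∃ g, f = 2 * g := ⟨f / 2, by have := h.f_mod; omega⟩
  have hk' : (d : L) + e = 4 * k := by exact_mod_cast hk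
  have hg' : (f : L) = 2 * g := by exact_mod_cast hg
  have : ((b + c) / 2) ^ 2 = ((2 * k * g : ℤ) : L) + (g : ℤ) * a := by
    push_cast
    have hb := h.b_sq
    have hc := h.c_sq
    have hbc := h.b_mul_c
    rw [hg'] at hb hc hbc
    linear_combination (hb + hc + 2 * hbc) / 4 + g / 2 * hk'
  rw [this]
  have hi (n : ℤ) : IsIntegral ℤ (n : L) := isIntegral_algebraMap (R := ℤ) (A := L) (x := n)
  exact (hi _).add ((hi g).mul h.isIntegral_a)

/-! ### Norm forms and the size of the generator -/

/-- If `𝓞_L` is cyclic over the associated order of a Hopf-Galois structure acting on `ℚb + ℚc`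
through the complex multiplication `b ↦ dc`, `c ↦ -eb`, then the definite form `dX² + eY²`
represents `1` on half-integers, so `d = 1` or `e = 1`. -/
theorem eq_one_or_eq_one (h : SqrtTriple d e f a b c σ τ) (hd : 0 < d) (he : 0 < e)
    {N : Subgroup (Equiv.Perm (L ≃ₐ[ℚ] L))}
    (hact : ∀ y : hopfAlgebra N, ∃ x₀ x₁ u v : ℚ, ∀ X Y Z W : ℚ,
      action N y (X + Y * a + Z * b + W * c) =
        (x₀ * X : ℚ) + (x₁ * Y : ℚ) * a + (u * Z - v * e * W : ℚ) * b + (u * W + v * d * Z : ℚ) * c)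
    (hgen : ∃ β : L, IsIntegral ℤ β ∧ ∀ x : L, IsIntegral ℤ x → ∃ y : hopfAlgebra N,
      y ∈ associatedOrder N ∧ action N y β = x) : d = 1 ∨ e = 1 := by
  obtain ⟨β, hβ, hgen⟩ := hgen
  obtain ⟨X, Y, Z, W, rfl⟩ := h.exists_repr β
  obtain ⟨-, -, z, w, -, -, hz, hw, hzw⟩ := h.exists_int_coords hβ
  have hnorm (y : hopfAlgebra N) (hy : y ∈ associatedOrder N) {x : L} {Z' W' : ℚ}
      (hyx : action N y (X + Y * a + Z * b + W * c) = x)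
      (hx : x = (0 : ℚ) + (0 : ℚ) * a + Z' * b + W' * c) :
      ∃ n : ℤ, n * (d * Z ^ 2 + e * W ^ 2) = d * Z' ^ 2 + e * W' ^ 2 := by
    obtain ⟨x₀, x₁, u, v, hy'⟩ := hact y
    have hb := hy _ h.isIntegral_b
    have hbc := hy _ h.isIntegral_half
    rw [show b = (0 : ℚ) + (0 : ℚ) * a + (1 : ℚ) * b + (0 : ℚ) * c by simp, hy'] at hb
    rw [show (b + c) / 2 = (0 : ℚ) + (0 : ℚ) * a + (1 / 2 : ℚ) * b + (1 / 2 : ℚ) * c by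
      push_cast; ring, hy'] at hbc
    obtain ⟨-, -, p, r, -, -, hp, hr, hpr⟩ := h.exists_int_coords hb
    obtain ⟨-, -, p', q, -, -, hp', hq, hpq⟩ := h.exists_int_coords hbc
    obtain ⟨j, hj⟩ : Even (p - r) := Int.even_sub.2 hpr
    obtain ⟨k, hk⟩ : Even (q - p') := Int.even_sub.2 hpq.symm
    have hj' : (p : ℚ) - r = j + j := by exact_mod_cast hj
    have hk' : (q : ℚ) - p' = k + k := by exact_mod_cast hk
    rw [hy', hx] at hyx
    obtain ⟨-, -, h3, h4⟩ := h.coord_ext hyx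
    -- In the lattice basis b, (b + c)/2 the element y has rows (j, r) and (-k, q); the witness is
    -- its determinant, equal to u² + dev².
    refine ⟨j * q + r * k, ?_⟩
    have hjv : (j : ℚ) = u - v * d := by linear_combination (hr - hp - hj') / 2
    have hkv : (k : ℚ) = v * (d + e) / 2 := by linear_combination (hp' - hq - hk') / 2
    push_cast
    rw [← h3, ← h4, hjv, hkv, ← hq, ← hr]
    ring
  obtain ⟨y₁, hy₁, e₁⟩ := hgen b h.isIntegral_b
  obtain ⟨y₂, hy₂, e₂⟩ := hgen _ h.isIntegral_half
  obtain ⟨n₁, hn₁⟩ := hnorm y₁ hy₁ e₁ (Z' := 1) (W' := 0) (by simp)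
  obtain ⟨n₂, hn₂⟩ := hnorm y₂ hy₂ e₂ (Z' := 1 / 2) (W' := 1 / 2) (by push_cast; ring)
  obtain ⟨k, hk⟩ := h.four_dvd_add
  -- The form is integral at β: z and w have the same parity, and odd squares contribute d + e ≡ 0
  -- modulo 4.
  obtain ⟨Q, hQ⟩ : ∃ Q : ℤ, d * z ^ 2 + e * w ^ 2 = 4 * Q := by
    change (4 : ℤ) ∣ _
    rcases Int.even_or_odd z with hz' | hz'
    · obtain ⟨w', rfl⟩ := hzw.1 hz'
      obtain ⟨z', rfl⟩ := hz'
      exact ⟨d * z' ^ 2 + e * w' ^ 2, by ring⟩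
    · have hw' : Odd w := Int.not_even_iff_odd.1 fun hw' =>
        Int.not_even_iff_odd.2 hz' (hzw.2 hw')
      obtain ⟨z', rfl⟩ := hz'
      obtain ⟨w', rfl⟩ := hw'
      exact ⟨d * (z' ^ 2 + z') + e * (w' ^ 2 + w') + k, by linear_combination hk⟩
  have hQ' : d * Z ^ 2 + e * W ^ 2 = Q := by
    have : (d : ℚ) * z ^ 2 + e * w ^ 2 = 4 * Q := by exact_mod_cast hQ
    rw [← hz, ← hw] at this
    linarith
  rw [hQ'] at hn₁ hn₂
  have hQd : Q ∣ d := ⟨n₁, by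
    have : (d : ℚ) = Q * n₁ := by linear_combination -hn₁
    exact_mod_cast this⟩
  have hQk : Q ∣ d + e := ⟨4 * n₂, by
    have : (d : ℚ) + e = Q * (4 * n₂) := by linear_combination -4 * hn₂
    exact_mod_cast this⟩
  have hQe : Q ∣ e := (dvd_add_right hQd).1 hQk
  have hQu := Int.isUnit_iff.1 (h.squarefree_de Q (mul_dvd_mul hQd hQe))
  -- Now d and e are odd and at least 3, so dz² + ew² = 4Q ≤ 4 forces |z|, |w| ≤ 1. Equal parity
  -- leaves only the values 0 and d + e ≥ 6, neither of which is ±4.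
  by_contra! hne
  have hd3 : 3 ≤ d := by
    obtain ⟨l, hl⟩ := h.odd_d
    have := hne.1
    omega
  have he3 : 3 ≤ e := by
    obtain ⟨l, hl⟩ := h.odd_e
    have := hne.2
    omega
  have hz0 := sq_nonneg z
  have hw0 := sq_nonneg w
  have h1 : 3 * z ^ 2 + 3 * w ^ 2 ≤ 4 := by
    have : 4 * Q ≤ 4 := by omega
    nlinarith
  have hzle : z ^ 2 ≤ 1 := by omega
  have hwle : w ^ 2 ≤ 1 := by omega
  have hzb : z = -1 ∨ z = 0 ∨ z = 1 := by
    have := abs_le.1 (sq_le_one_iff_abs_le_one z |>.1 hzle)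
    omega
  have hwb : w = -1 ∨ w = 0 ∨ w = 1 := by
    have := abs_le.1 (sq_le_one_iff_abs_le_one w |>.1 hwle)
    omega
  rcases hzb with rfl | rfl | rfl <;> rcases hwb with rfl | rfl | rfl <;> simp at hQ hzw h1 <;>
    omega

/-- If `𝓞_L` is cyclic over the associated order of a Hopf-Galois structure acting on `ℚa + ℚc`
through the complex multiplication `a ↦ dc`, `c ↦ -fa`, then the definite form
`±(2dX² + (f / 2)Y²)` represents `1` on integers, so `|f| = 2`. -/
theorem abs_eq_two (h : SqrtTriple d e f a b c σ τ) (hdf : 0 < d * f)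
    {N : Subgroup (Equiv.Perm (L ≃ₐ[ℚ] L))}
    (hact : ∀ y : hopfAlgebra N, ∃ x₀ x₁ u v : ℚ, ∀ X Y Z W : ℚ,
      action N y (X + Y * a + Z * b + W * c) =
        (x₀ * X : ℚ) + (u * Y - v * f * W : ℚ) * a + (x₁ * Z : ℚ) * b + (u * W + v * d * Y : ℚ) * c)
    (hgen : ∃ β : L, IsIntegral ℤ β ∧ ∀ x : L, IsIntegral ℤ x → ∃ y : hopfAlgebra N,
      y ∈ associatedOrder N ∧ action N y β = x) : |f| = 2 := by
  obtain ⟨β, hβ, hgen⟩ := hgen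
  obtain ⟨X, Y, Z, W, rfl⟩ := h.exists_repr β
  obtain ⟨-, y, -, w, -, hY, -, hw, -⟩ := h.exists_int_coords hβ
  obtain ⟨g, hg⟩ : ∃ g, f = 2 * g := ⟨f / 2, by have := h.f_mod; omega⟩
  have hg' : (f : ℚ) = 2 * g := by exact_mod_cast hg
  have hnorm (y : hopfAlgebra N) (hy : y ∈ associatedOrder N) {x : L} {Y' Z' W' : ℚ}
      (hyx : action N y (X + Y * a + Z * b + W * c) = x)
      (hx : x = (0 : ℚ) + Y' * a + Z' * b + W' * c) :
      ∃ n : ℤ, n * (d * Y ^ 2 + f * W ^ 2) = d * Y' ^ 2 + f * W' ^ 2 := by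
    obtain ⟨x₀, x₁, u, v, hy'⟩ := hact y
    have ha := hy _ h.isIntegral_a
    have hbc := hy _ h.isIntegral_half
    rw [show a = (0 : ℚ) + (1 : ℚ) * a + (0 : ℚ) * b + (0 : ℚ) * c by simp, hy'] at ha
    rw [show (b + c) / 2 = (0 : ℚ) + (0 : ℚ) * a + (1 / 2 : ℚ) * b + (1 / 2 : ℚ) * c by
      push_cast; ring, hy'] at hbc
    obtain ⟨-, p, -, r, -, hp, -, hr, -⟩ := h.exists_int_coords ha
    obtain ⟨-, q, -, -, -, hq, -, -, -⟩ := h.exists_int_coords hbc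
    rw [hy', hx] at hyx
    obtain ⟨-, h3, -, h4⟩ := h.coord_ext hyx
    -- The projection of 𝓞_L to the plane has basis a, c/2, in which y has rows (p, r) and (q, p);
    -- its determinant is u² + dfv².
    refine ⟨p ^ 2 - r * q, ?_⟩
    push_cast
    rw [← h3, ← h4, ← hp, ← hq, ← hr]
    ring
  obtain ⟨y₁, hy₁, e₁⟩ := hgen a h.isIntegral_a
  obtain ⟨y₂, hy₂, e₂⟩ := hgen _ h.isIntegral_half
  obtain ⟨n₁, hn₁⟩ := hnorm y₁ hy₁ e₁ (Y' := 1) (Z' := 0) (W' := 0) (by simp)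
  obtain ⟨n₂, hn₂⟩ := hnorm y₂ hy₂ e₂ (Y' := 0) (Z' := 1 / 2) (W' := 1 / 2) (by push_cast; ring)
  -- Doubling clears the denominator, since W = w/2 and f = 2g. The test elements a and (b + c)/2
  -- have doubled values 2d and g, whose product is df.
  set Q := 2 * d * y ^ 2 + g * w ^ 2 with hQ
  have hQ' : 2 * (d * Y ^ 2 + f * W ^ 2) = Q := by
    rw [hQ]
    push_cast
    rw [← hw, ← hY, hg']
    ring
  have hQd : Q ∣ 2 * d := ⟨n₁, by
    have : (2 * d : ℚ) = Q * n₁ := by linear_combination -2 * hn₁ + n₁ * hQ'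
    exact_mod_cast this⟩
  have hQg : Q ∣ g := ⟨n₂, by
    have : (g : ℚ) = Q * n₂ := by linear_combination -2 * hn₂ + n₂ * hQ' - hg' / 2
    exact_mod_cast this⟩
  have hdg : d * f = 2 * d * g := by rw [hg]; ring
  have hQu := Int.isUnit_iff.1 (h.squarefree_df Q (hdg ▸ mul_dvd_mul hQd hQg))
  have hpos : 0 < d * g := by nlinarith
  have hy0 := sq_nonneg y
  have hw0 := sq_nonneg w
  have hg1 : |g| = 1 := by
    rcases pos_and_pos_or_neg_and_neg_of_mul_pos hpos with ⟨hd0, hg0⟩ | ⟨hd0, hg0⟩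
    -- Both terms of Q have the same sign, and a nonzero y would contribute at least 2 in absolute
    -- value.
    · have hyz : y ^ 2 = 0 := by
        by_contra hne
        have h1 := mul_pos hd0 (show 0 < y ^ 2 by omega)
        have h2 := mul_nonneg hg0.le hw0
        rcases hQu with hQu | hQu <;> linarith
      have : g * w ^ 2 = 1 := by
        have : Q = g * w ^ 2 := by rw [hQ, hyz]; ring
        have : 0 ≤ g * w ^ 2 := by positivity
        omega
      exact Int.isUnit_iff_abs_eq.1 (IsUnit.of_mul_eq_one _ this)
    · have hyz : y ^ 2 = 0 := by
        by_contra hne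
        have h1 := mul_neg_of_neg_of_pos hd0 (show 0 < y ^ 2 by omega)
        have h2 := mul_nonpos_of_nonpos_of_nonneg hg0.le hw0
        rcases hQu with hQu | hQu <;> linarith
      have : g * -w ^ 2 = 1 := by
        have : Q = g * w ^ 2 := by rw [hQ, hyz]; ring
        have : 0 ≤ -g * w ^ 2 := mul_nonneg (by omega) hw0
        rw [mul_neg]
        rw [neg_mul] at this
        omega
      exact Int.isUnit_iff_abs_eq.1 (IsUnit.of_mul_eq_one _ this)
  rw [hg, abs_mul, hg1]
  rfl

/-! ### The three structures, with s = a, b, c -/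

theorem isBiquadratic_a (h : SqrtTriple d e f a b c σ τ) : IsBiquadratic a b σ τ where
  S_s := h.σ_a
  S_p := h.σ_b
  T_s := h.τ_a
  T_p := h.τ_b
  s_ne := h.a_ne
  p_ne := h.b_ne
  sq_s := ⟨d * e, by rw [h.a_sq]; push_cast; rfl⟩
  sq_p := ⟨d * f, by rw [h.b_sq]; push_cast; rfl⟩
  exists_repr z := by
    obtain ⟨X, Y, Z, W, rfl⟩ := h.exists_repr z
    have hd : (d : L) ≠ 0 := by exact_mod_cast h.d_ne
    refine ⟨X, Y, Z, W / d, ?_⟩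
    rw [h.a_mul_b]
    push_cast
    field_simp

theorem isBiquadratic_b (h : SqrtTriple d e f a b c σ τ) : IsBiquadratic b a τ σ where
  S_s := h.τ_b
  S_p := h.τ_a
  T_s := h.σ_b
  T_p := h.σ_a
  s_ne := h.b_ne
  p_ne := h.a_ne
  sq_s := h.isBiquadratic_a.sq_p
  sq_p := h.isBiquadratic_a.sq_s
  exists_repr z := by
    obtain ⟨X, Y, Z, W, rfl⟩ := h.isBiquadratic_a.exists_repr z
    exact ⟨X, Z, Y, W, by ring⟩

theorem isBiquadratic_c (h : SqrtTriple d e f a b c σ τ) : IsBiquadratic c b σ (σ * τ) where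
  S_s := h.σ_c
  S_p := h.σ_b
  T_s := h.swap.σ_b
  T_p := by simp [h.τ_b, h.σ_b]
  s_ne := h.c_ne
  p_ne := h.b_ne
  sq_s := h.swap.isBiquadratic_a.sq_p
  sq_p := h.isBiquadratic_a.sq_p
  exists_repr z := by
    obtain ⟨X, Y, Z, W, rfl⟩ := h.exists_repr z
    have hf : (f : L) ≠ 0 := by exact_mod_cast h.f_ne
    refine ⟨X, W, Z, Y / f, ?_⟩
    rw [mul_comm c b, h.b_mul_c]
    push_cast
    field_simp
    ring

theorem map_coords (φ : Module.End ℚ L) (X Y Z W : ℚ) :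
    φ (X + Y * a + Z * b + W * c) = X * φ 1 + Y * φ a + Z * φ b + W * φ c := by
  have hq (q : ℚ) (x : L) : φ (q * x) = q * φ x := by
    rw [← Rat.smul_def, map_smul, Rat.smul_def]
  rw [map_add, map_add, map_add, hq, hq, hq, ← mul_one (X : L), hq, mul_one]

theorem not_free_of_pos_a [NumberField L] (h : SqrtTriple d e f a b c σ τ) (hd : 0 < d)
    (he : 0 < e) (hd1 : d ≠ 1) (he1 : e ≠ 1) :
    ¬ Module.Free (associatedOrder (typeC4Subgroup σ τ)) (𝓞 L) := by
  intro hfree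
  refine (h.eq_one_or_eq_one hd he (fun y => ?_) h.isBiquadratic_a.exists_generator).elim hd1 he1
  obtain ⟨x₀, x₁, u, v, h0, h1, h2, h3⟩ := h.isBiquadratic_a.action_eq y
  refine ⟨x₀, x₁, u, v, fun X Y Z W => ?_⟩
  rw [map_coords, h0, h1, h2, h3 c h.σ_c h.τ_c, h.a_mul_b, h.a_mul_c]
  push_cast
  ring

theorem not_free_of_pos_b [NumberField L] (h : SqrtTriple d e f a b c σ τ) (hdf : 0 < d * f)
    (hf : |f| ≠ 2) :
    ¬ Module.Free (associatedOrder (typeC4Subgroup τ σ)) (𝓞 L) := by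
  intro hfree
  refine hf (h.abs_eq_two hdf (fun y => ?_) h.isBiquadratic_b.exists_generator)
  obtain ⟨x₀, x₁, u, v, h0, h1, h2, h3⟩ := h.isBiquadratic_b.action_eq y
  refine ⟨x₀, x₁, u, v, fun X Y Z W => ?_⟩
  rw [map_coords, h0, h1, h2, h3 c h.τ_c h.σ_c, mul_comm b a, h.a_mul_b, h.b_mul_c]
  push_cast
  ring

theorem not_free_of_pos_c [NumberField L] (h : SqrtTriple d e f a b c σ τ) (hef : 0 < e * f)
    (hf : |f| ≠ 2) :
    ¬ Module.Free (associatedOrder (typeC4Subgroup σ (σ * τ))) (𝓞 L) := by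
  intro hfree
  refine hf (h.swap.abs_eq_two hef (fun y => ?_) h.isBiquadratic_c.exists_generator)
  obtain ⟨x₀, x₁, u, v, h0, h1, h2, h3⟩ := h.isBiquadratic_c.action_eq y
  -- Here J sends b to fa and a to -eb, the negative of the map expected after the swap.
  refine ⟨x₀, x₁, u, -v, fun X Y Z W => ?_⟩
  rw [map_coords, h0, h1, h2, h3 a h.σ_a h.swap.σ_a, mul_comm c a, h.a_mul_c, mul_comm c b,
    h.b_mul_c]
  push_cast
  ring

end SqrtTriple

/-! ### From m and n to d, e and f -/

/-- The rational span of 1, a, b, c is closed under multiplication, and L is algebraic, so adjoining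
a and b as a ring already gives L. -/
theorem exists_repr_of_adjoin_eq_top {L : Type*} [Field L] [NumberField L] {a b c : L}
    {d e f : ℚ} (hd : d ≠ 0) (ha : a ^ 2 = d * e) (hb : b ^ 2 = d * f) (hab : a * b = d * c)
    (hL : IntermediateField.adjoin ℚ {a, b} = ⊤) (z : L) :
    ∃ X Y Z W : ℚ, z = X + Y * a + Z * b + W * c := by
  have hz : z ∈ Algebra.adjoin ℚ {a, b} := by
    rw [← IntermediateField.adjoin_toSubalgebra_of_isAlgebraic fun x _ =>
      Algebra.IsAlgebraic.isAlgebraic x, hL]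
    trivial
  have hd' : (d : L) ≠ 0 := by exact_mod_cast hd
  have hac : a * c = e * b := by
    apply mul_left_cancel₀ hd'
    linear_combination b * ha - a * hab
  have hbc : b * c = f * a := by
    apply mul_left_cancel₀ hd'
    linear_combination a * hb - b * hab
  have hc : c ^ 2 = e * f := by
    apply mul_left_cancel₀ hd'
    linear_combination e * hb + b * hac - c * hab
  induction hz using Algebra.adjoin_induction with
  | mem x hx =>
    rcases hx with rfl | rfl
    · exact ⟨0, 1, 0, 0, by simp⟩
    · exact ⟨0, 0, 1, 0, by simp⟩
  | algebraMap r => exact ⟨r, 0, 0, 0, by simp⟩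
  | add x y _ _ hx hy =>
    obtain ⟨X, Y, Z, W, rfl⟩ := hx
    obtain ⟨X', Y', Z', W', rfl⟩ := hy
    exact ⟨X + X', Y + Y', Z + Z', W + W', by push_cast; ring⟩
  | mul x y _ _ hx hy =>
    obtain ⟨X, Y, Z, W, rfl⟩ := hx
    obtain ⟨X', Y', Z', W', rfl⟩ := hy
    refine ⟨X * X' + d * e * Y * Y' + d * f * Z * Z' + e * f * W * W',
      X * Y' + Y * X' + f * (Z * W' + W * Z'), X * Z' + Z * X' + e * (Y * W' + W * Y'),
      X * W' + W * X' + d * (Y * Z' + Z * Y'), ?_⟩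
    push_cast
    linear_combination (Y * Y' : L) * ha + (Z * Z' : L) * hb + (W * W' : L) * hc +
      (Y * Z' + Z * Y' : L) * hab + (Y * W' + W * Y' : L) * hac + (Z * W' + W * Z' : L) * hbc

theorem sqrtTriple_of_adjoin_eq_top {L : Type*} [Field L] [NumberField L] {d e f : ℤ} {a b : L}
    {σ τ : L ≃ₐ[ℚ] L} (hm : Squarefree (d * e)) (hn : Squarefree (d * f)) (hef : IsCoprime e f)
    (hm4 : d * e % 4 = 3) (hn4 : d * f % 4 = 2)
    (ha : a ^ 2 = (d : L) * e) (hb : b ^ 2 = (d : L) * f)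
    (hL : IntermediateField.adjoin ℚ {a, b} = ⊤)
    (hσa : σ a = -a) (hσb : σ b = b) (hτa : τ a = a) (hτb : τ b = -b) :
    SqrtTriple d e f a b (a * b / d) σ τ := by
  have hd0 : d ≠ 0 := by
    rintro rfl
    simp at hm4
  have hd : (d : L) ≠ 0 := by exact_mod_cast hd0
  have hdo : Odd (d * e) := Int.odd_iff.2 (by omega)
  have hdo := (Int.odd_mul.1 hdo).1
  refine
    { squarefree_de := hm
      squarefree_df := hn
      squarefree_ef := ?_
      de_mod := hm4
      f_mod := ?_
      a_sq := ha
      b_sq := hb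
      c_sq := ?_
      a_mul_b := by field_simp
      a_mul_c := ?_
      b_mul_c := ?_
      σ_a := hσa
      σ_b := hσb
      σ_c := by simp [hσa, hσb, neg_div]
      τ_a := hτa
      τ_b := hτb
      τ_c := by simp [hτa, hτb, neg_div]
      exists_repr := ?_ }
  · exact (squarefree_mul_iff.2 ⟨hef.isRelPrime, hm.of_mul_right, hn.of_mul_right⟩)
  · have hdm : d % 4 = 1 ∨ d % 4 = 3 := by
      have := Int.odd_iff.1 hdo
      omega
    have hfm : f % 4 = 0 ∨ f % 4 = 1 ∨ f % 4 = 2 ∨ f % 4 = 3 := by omega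
    rw [Int.mul_emod] at hn4
    rcases hdm with hdm | hdm <;> rcases hfm with hfm | hfm | hfm | hfm <;>
      rw [hdm, hfm] at hn4 <;> omega
  · rw [div_pow, mul_pow, ha, hb]
    field_simp
  · rw [mul_div_assoc', ← mul_assoc, ← sq, ha]
    field_simp
  · rw [mul_div_assoc', mul_comm a b, ← mul_assoc, ← sq, hb]
    field_simp
  · exact exists_repr_of_adjoin_eq_top (d := d) (e := e) (f := f) (by exact_mod_cast hd0)
      (by simpa using ha) (by simpa using hb) (by simp; field_simp) hL

end HopfGalois

/-- Let `L = ℚ(√m, √n)` with `m ≡ 3`, `n ≡ 2 (mod 4)` square-free, and let `σ, τ` be the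
automorphisms with `L^⟨τ⟩ = ℚ(√m)`, `L^⟨σ⟩ = ℚ(√n)`, so that `L^⟨στ⟩ = ℚ(√k)`.  The Hopf-Galois
structures `H₁`, `H₂`, `H₃` are those attached to `⟨τ⟩`, `⟨σ⟩`, `⟨στ⟩`. -/
theorem mainTheorem3 {L : Type*} [Field L] [NumberField L]
    (m n d k : ℤ) (hm : Squarefree m) (hn : Squarefree n)
    (hm4 : m ≡ 3 [ZMOD 4]) (hn4 : n ≡ 2 [ZMOD 4])
    (hd : d = Int.gcd m n) (hk : k = m * n / d ^ 2)
    (a b : L) (ha : a ^ 2 = (m : L)) (hb : b ^ 2 = (n : L))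
    (hL : IntermediateField.adjoin ℚ {a, b} = ⊤)
    (σ τ : L ≃ₐ[ℚ] L)
    (hσa : σ a = -a) (hσb : σ b = b) (hτa : τ a = a) (hτb : τ b = -b) :
    (0 < m → ¬ (IsCoprime m n ∨ m ∣ n) →
      ¬ Module.Free (HopfGalois.associatedOrder (HopfGalois.typeC4Subgroup σ τ)) (𝓞 L)) ∧
    (0 < n → n ≠ 2 * d →
      ¬ Module.Free (HopfGalois.associatedOrder (HopfGalois.typeC4Subgroup τ σ)) (𝓞 L)) ∧
    (0 < k → |n| ≠ 2 * d →
      ¬ Module.Free (HopfGalois.associatedOrder (HopfGalois.typeC4Subgroup σ (σ * τ))) (𝓞 L)) := by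
  have hd0 : d ≠ 0 := by
    rw [hd]
    intro h0
    have := Int.gcd_eq_zero_iff.1 (by exact_mod_cast h0)
    exact hm.ne_zero this.1
  have hdpos : 0 < d := lt_of_le_of_ne (by rw [hd]; positivity) hd0.symm
  obtain ⟨e, he⟩ : d ∣ m := hd ▸ Int.gcd_dvd_left m n
  obtain ⟨f, hf⟩ : d ∣ n := hd ▸ Int.gcd_dvd_right m n
  have hef : IsCoprime e f := by
    have hbez := Int.gcd_eq_gcd_ab m n
    rw [← hd] at hbez
    refine ⟨Int.gcdA m n, Int.gcdB m n, mul_left_cancel₀ hd0 ?_⟩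
    linear_combination -hbez - Int.gcdA m n * he - Int.gcdB m n * hf
  have hk' : k = e * f := by
    rw [hk, he, hf, show d * e * (d * f) = d ^ 2 * (e * f) by ring,
      Int.mul_ediv_cancel_left _ (pow_ne_zero 2 hd0)]
  have h : HopfGalois.SqrtTriple d e f a b (a * b / d) σ τ :=
    HopfGalois.sqrtTriple_of_adjoin_eq_top (he ▸ hm) (hf ▸ hn) hef (he ▸ hm4) (hf ▸ hn4)
      (by rw [ha, he]; push_cast; rfl) (by rw [hb, hf]; push_cast; rfl) hL hσa hσb hτa hτb
  refine ⟨fun hm0 hmn => ?_, fun hn0 hnd => ?_, fun hk0 hnd => ?_⟩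
  -- The case d = 1 makes m and n coprime, and e = 1 makes m divide n.
  · refine h.not_free_of_pos_a hdpos (pos_of_mul_pos_right (he ▸ hm0) hdpos.le) ?_ ?_
    · rintro rfl
      exact hmn (Or.inl (Int.isCoprime_iff_gcd_eq_one.2 (by exact_mod_cast hd.symm)))
    · rintro rfl
      exact hmn (Or.inr ⟨f, by rw [he, mul_one, hf]⟩)
  · have hf0 : 0 < f := pos_of_mul_pos_right (hf ▸ hn0) hdpos.le
    refine h.not_free_of_pos_b (hf ▸ hn0) fun hf2 => hnd ?_
    rw [abs_of_pos hf0] at hf2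
    rw [hf, hf2, mul_comm]
  · refine h.not_free_of_pos_c (hk' ▸ hk0) fun hf2 => hnd ?_
    rw [hf, abs_mul, hf2, abs_of_pos hdpos, mul_comm]
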